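/- Let $m,k\ge 0$ be integers with $m\ge 2k$. Let $S_m$ act on $\mathbb C[\alpha_1,\dots,\alpha_m]$ by permuting the variables, and let $SF_{m,k}$ be the span of the square-free monomials $\alpha_I=\prod_{i\in I}\alpha_i$, where $I\subset\{1,\dots,m\}$ and $|I|=k$. Let $OG(k,m)$ be the variety of $k$-dimensional subspaces of $\mathbb C^m$ that are isotropic for $Q_1=x_1^2+\cdots+x_m^2$, let $U$ be its tautological bundle, $\mathcal O(1)=\det U^\vee$ the Plücker line bundle, and $p_I$ the Plücker coordinates; $S_m$ acts on $OG(k,m)$ and on $H^0(OG(k,m),\mathcal O(2))$ by permuting the coordinates of $\mathbb C^m$. Let $$\rho_{m,k}: SF_{m,k}\longrightarrow H^0(OG(k,m),\mathcal O(2)),\qquad \alpha_I\longmapsto p_I^2 ,$$ be the resulting $S_m$-equivariant linear map. Then the image of $\rho_{m,k}$ is an irreducible representation of $S_m$, isomorphic to the Specht module $[m-k,k]$, that is, to the span in $\mathbb C[\alpha_1,\dots,\alpha_m]$ of the polynomials $\prod_{j=1}^{k}(\alpha_{a_j}-\alpha_{b_j})$, where $a_1,\dots,a_{m-k}$ and $b_1,\dots,b_k$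 are the entries of the first and second rows of a numbering by $1,\dots,m$ of the boxes of the Young diagram of shape $(m-k,k)$. Moreover $\rho_{m,k}$ vanishes on $\alpha_J\sum_{a\notin J}\alpha_a\in SF_{m,k}$ for every $J\subset\{1,\dots,m\}$ with $|J|=k-1$. -/

import Mathlib

open scoped BigOperators

noncomputable section

namespace CobleOG

/-! ### Symmetric group representations on polynomials -/

/-- `S_m` acting on `ℂ[α_1, …, α_m]` by permuting the variables: `σ · α_i = α_{σ i}`. -/
def polyRep (m : ℕ) :
    Representation ℂ (Equiv.Perm (Fin m)) (MvPolynomial (Fin m) ℂ) where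
  toFun σ := (MvPolynomial.rename (R := ℂ) σ).toLinearMap
  map_one' := by
    apply LinearMap.ext
    intro p
    change MvPolynomial.rename (id : Fin m → Fin m) p = p
    exact MvPolynomial.rename_id_apply p
  map_mul' σ τ := by
    apply LinearMap.ext
    intro p
    change MvPolynomial.rename (σ ∘ τ) p = MvPolynomial.rename σ (MvPolynomial.rename τ p)
    rw [MvPolynomial.rename_rename]

/-- The square-free monomial `α_I = ∏_{i ∈ I} α_i`. -/
def sfMonomial {m : ℕ} (I : Finset (Fin m)) : MvPolynomial (Fin m) ℂ :=
  ∏ i ∈ I, MvPolynomial.X i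

lemma polyRep_sfMonomial {m : ℕ} (σ : Equiv.Perm (Fin m)) (I : Finset (Fin m)) :
    polyRep m σ (sfMonomial I) = sfMonomial (I.map σ.toEmbedding) := by
  change MvPolynomial.rename σ (sfMonomial I) = _
  simp [sfMonomial]

/-- The span of a family of polynomials that is stable under `S_m`, as a subrepresentation. -/
def spanRep {m : ℕ} {ι : Type*} (P : ι → MvPolynomial (Fin m) ℂ)
    (h : ∀ (σ : Equiv.Perm (Fin m)) (t : ι), ∃ s, polyRep m σ (P t) = P s) :
    Subrepresentation (polyRep m) where
  toSubmodule := Submodule.span ℂ (Set.range P)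
  apply_mem_toSubmodule σ v hv := by
    induction hv using Submodule.span_induction with
    | mem x hx =>
      obtain ⟨t, rfl⟩ := hx
      obtain ⟨s, hs⟩ := h σ t
      rw [hs]
      exact Submodule.subset_span ⟨s, rfl⟩
    | zero => simp
    | add x y _ _ hx hy => rw [map_add]; exact Submodule.add_mem _ hx hy
    | smul c x _ hx => rw [map_smul]; exact Submodule.smul_mem _ c hx

/-- `SF_{m,k}`: the representation of `S_m` on the span of the square-free monomials of degree
`k` in `m` variables. -/
def SF (m k : ℕ) : Subrepresentation (polyRep m) :=
  spanRep (fun I : {I : Finset (Fin m) // I.card = k} => sfMonomial I.1)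
    (fun σ I => ⟨⟨I.1.map σ.toEmbedding, by rw [Finset.card_map, I.2]⟩,
      polyRep_sfMonomial σ I.1⟩)

/-- `α_I` as an element of `SF_{m,k}`. -/
def alphaMon {m k : ℕ} (I : {I : Finset (Fin m) // I.card = k}) : (SF m k).toSubmodule :=
  ⟨sfMonomial I.1, Submodule.subset_span ⟨I, rfl⟩⟩

/-! ### Specht modules -/

/-- The Specht polynomial of a numbering `T` of the boxes of a Young diagram `μ` by the indices
of `m` variables: the product, over all pairs of boxes lying in the same column, of
(variable of the upper box) - (variable of the lower box). Boxes are pairs (row, column).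
For two rows with entries `a_1, a_2, …` and `b_1, …, b_p` this is `∏_j (α_{a_j} - α_{b_j})`. -/
def spechtPoly {m : ℕ} (μ : YoungDiagram) (T : μ.cells ≃ Fin m) : MvPolynomial (Fin m) ℂ :=
  ∏ c : μ.cells × μ.cells with c.1.1.2 = c.2.1.2 ∧ c.1.1.1 < c.2.1.1,
    (MvPolynomial.X (T c.1) - MvPolynomial.X (T c.2))

/-- The Specht module `[μ]` of `S_m`, for `μ` a partition of `m`: the span of the Specht
polynomials of all numberings of the boxes of `μ`. -/
def specht (m : ℕ) (μ : YoungDiagram) : Subrepresentation (polyRep m) :=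
  spanRep (fun T : μ.cells ≃ Fin m => spechtPoly μ T)
    (fun σ T => ⟨T.trans σ, by
      change MvPolynomial.rename σ (spechtPoly μ T) = _
      simp [spechtPoly]⟩)

/-- The partition `(m - k, k)` of `m`, when `2 k ≤ m`. -/
def twoRow (m k : ℕ) (h : 2 * k ≤ m) : YoungDiagram :=
  YoungDiagram.ofRowLens [m - k, k] (by
    rw [List.sortedGE_iff_pairwise]
    simp
    omega)

/-! ### The orthogonal Grassmannian and the sections of `O(d)` -/

/-- `OG(k,m)`: the `k`-dimensional subspaces of `ℂ^m` that are isotropic for the quadratic form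
`x_1² + ⋯ + x_m²`. -/
def OG (k m : ℕ) : Set (Submodule ℂ (Fin m → ℂ)) :=
  {U | Module.finrank ℂ U = k ∧ ∀ x ∈ U, ∀ y ∈ U, ∑ i, x i * y i = 0}

/-- The frame bundle of the tautological bundle `U` over `OG(k,m)`: the `m × k` matrices whose
columns form a basis of a member of `OG(k,m)`. -/
def frames (k m : ℕ) : Set (Matrix (Fin m) (Fin k) ℂ) :=
  {A | LinearIndependent ℂ A.col ∧ Submodule.span ℂ (Set.range A.col) ∈ OG k m}

lemma mem_frames_iff {k m : ℕ} (A : Matrix (Fin m) (Fin k) ℂ) :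
    A ∈ frames k m ↔ LinearIndependent ℂ A.col ∧ ∀ a b, ∑ i, A i a * A i b = 0 := by
  constructor
  · rintro ⟨h1, -, h2⟩
    exact ⟨h1, fun a b => h2 _ (Submodule.subset_span ⟨a, rfl⟩) _ (Submodule.subset_span ⟨b, rfl⟩)⟩
  · rintro ⟨h1, h2⟩
    refine ⟨h1, ?_, ?_⟩
    · rw [finrank_span_eq_card h1, Fintype.card_fin]
    · intro x hx y hy
      change x ⬝ᵥ y = 0
      induction hx using Submodule.span_induction with
      | zero => simp
      | add x x' _ _ hx hx' => rw [add_dotProduct, hx, hx', add_zero]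
      | smul c x _ hx => rw [smul_dotProduct, hx, smul_zero]
      | mem x hx =>
        obtain ⟨a, rfl⟩ := hx
        induction hy using Submodule.span_induction with
        | zero => simp
        | add y y' _ _ hy hy' => rw [dotProduct_add, hy, hy', add_zero]
        | smul c y _ hy => rw [dotProduct_smul, hy, smul_zero]
        | mem y hy =>
          obtain ⟨b, rfl⟩ := hy
          exact h2 a b

/-- A regular function on the quasi-affine variety of frames: locally, in the Zariski topology,
it is a quotient of two polynomials in the matrix entries. -/
def IsRegular {k m : ℕ} (f : frames k m → ℂ) : Prop :=
  ∀ A : frames k m, ∃ P Q : MvPolynomial (Fin m × Fin k) ℂ,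
    MvPolynomial.eval (fun x => A.1 x.1 x.2) Q ≠ 0 ∧
    ∀ B : frames k m, MvPolynomial.eval (fun x => B.1 x.1 x.2) Q ≠ 0 →
      f B = MvPolynomial.eval (fun x => B.1 x.1 x.2) P /
        MvPolynomial.eval (fun x => B.1 x.1 x.2) Q

lemma IsRegular.add {k m : ℕ} {f g : frames k m → ℂ} (hf : IsRegular f) (hg : IsRegular g) :
    IsRegular (f + g) := by
  intro A
  obtain ⟨P, Q, hQ, h⟩ := hf A
  obtain ⟨P', Q', hQ', h'⟩ := hg A
  refine ⟨P * Q' + Q * P', Q * Q', by simp [hQ, hQ'], ?_⟩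
  intro B hB
  rw [map_mul] at hB
  have h1 := left_ne_zero_of_mul hB
  have h2 := right_ne_zero_of_mul hB
  simp only [Pi.add_apply, h B h1, h' B h2, map_add, map_mul]
  rw [div_add_div _ _ h1 h2]

lemma IsRegular.smul {k m : ℕ} (c : ℂ) {f : frames k m → ℂ} (hf : IsRegular f) :
    IsRegular (c • f) := by
  intro A
  obtain ⟨P, Q, hQ, h⟩ := hf A
  refine ⟨MvPolynomial.C c * P, Q, hQ, ?_⟩
  intro B hB
  simp [h B hB, mul_div_assoc]

/-- `H⁰(OG(k,m), O(d))`, where `O(1) = det U^∨` is the Plücker line bundle. The fibre of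
`(det U^∨)^{⊗ d}` at a subspace is the line of functions `f` on the set of its bases `A` with
`f (A g) = (det g)^d f A` for all changes of basis `g`; so a global section is a regular function
on the frame bundle with this property. -/
def sections (k m d : ℕ) : Submodule ℂ (frames k m → ℂ) where
  carrier := {f | IsRegular f ∧ ∀ (A B : frames k m) (g : Matrix (Fin k) (Fin k) ℂ),
    B.1 = A.1 * g → f B = g.det ^ d * f A}
  zero_mem' := ⟨fun A => ⟨0, 1, by simp⟩, fun A B g _ => by simp⟩
  add_mem' := by
    rintro f f' ⟨hf, hf2⟩ ⟨hf', hf2'⟩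
    refine ⟨hf.add hf', fun A B g h => ?_⟩
    rw [Pi.add_apply, Pi.add_apply, hf2 A B g h, hf2' A B g h, mul_add]
  smul_mem' := by
    rintro c f ⟨hf, hf2⟩
    refine ⟨hf.smul c, fun A B g h => ?_⟩
    rw [Pi.smul_apply, Pi.smul_apply, hf2 A B g h, smul_eq_mul, smul_eq_mul]
    ring

/-- The inverse of a permutation `σ` of the coordinates of `ℂ^m` (the linear map `σ` sends `e_i`
to `e_{σ i}`), applied to a frame. -/
def permFrame {k m : ℕ} (σ : Equiv.Perm (Fin m)) (A : frames k m) : frames k m :=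
  ⟨A.1.submatrix σ id, by
    have hA := (mem_frames_iff A.1).1 A.2
    refine (mem_frames_iff _).2 ⟨?_, fun a b => ?_⟩
    · exact hA.1.map' (LinearMap.funLeft ℂ ℂ σ)
        (LinearMap.ker_eq_bot.2 (LinearMap.funLeft_injective_of_surjective ℂ ℂ σ σ.surjective))
    · rw [← hA.2 a b]
      exact Equiv.sum_comp σ (fun i => A.1 i a * A.1 i b)⟩

/-- `S_m` acting on `H⁰(OG(k,m), O(d))` through its action on `ℂ^m` by permutation of the
coordinates: `(σ · s)(A) = s (σ⁻¹ A)`. -/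
def sectionsRep (k m d : ℕ) :
    Representation ℂ (Equiv.Perm (Fin m)) (sections k m d) where
  toFun σ :=
    { toFun := fun s => ⟨fun A => s.1 (permFrame σ A), by
        obtain ⟨f, hf, hf2⟩ := s
        refine ⟨fun A => ?_, fun A B g h => ?_⟩
        · obtain ⟨P, Q, hQ, h⟩ := hf (permFrame σ A)
          have key : ∀ (B : frames k m) (R : MvPolynomial (Fin m × Fin k) ℂ),
              MvPolynomial.eval (fun x => B.1 x.1 x.2)
                (MvPolynomial.rename (fun x : Fin m × Fin k => (σ x.1, x.2)) R) =
              MvPolynomial.eval (fun x => (permFrame σ B).1 x.1 x.2) R := by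
            intro B R
            rw [MvPolynomial.eval_rename]
            rfl
          refine ⟨MvPolynomial.rename (fun x : Fin m × Fin k => (σ x.1, x.2)) P,
            MvPolynomial.rename (fun x : Fin m × Fin k => (σ x.1, x.2)) Q, ?_, ?_⟩
          · rw [key]; exact hQ
          · intro B hB
            rw [key] at hB
            rw [key, key]
            exact h _ hB
        · refine hf2 _ _ g ?_
          ext i j
          simp [permFrame, h, Matrix.mul_apply]⟩
      map_add' := fun _ _ => rfl
      map_smul' := fun _ _ => rfl }
  map_one' := rfl
  map_mul' _ _ := rfl

/-- The Plücker coordinate `p_I` of the span of a frame `A`: the `k × k` minor of `A` on the rows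
in `I = {i_1 < ⋯ < i_k}`. -/
def plucker {k m : ℕ} (I : {I : Finset (Fin m) // I.card = k})
    (A : Matrix (Fin m) (Fin k) ℂ) : ℂ :=
  (A.submatrix (I.1.orderEmbOfFin I.2) id).det

lemma plucker_mul {k m : ℕ} (I : {I : Finset (Fin m) // I.card = k})
    (A : Matrix (Fin m) (Fin k) ℂ) (g : Matrix (Fin k) (Fin k) ℂ) :
    plucker I (A * g) = g.det * plucker I A := by
  unfold plucker
  rw [mul_comm, ← Matrix.det_mul]
  rfl

lemma plucker_eq_eval {k m : ℕ} (I : {I : Finset (Fin m) // I.card = k})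
    (A : Matrix (Fin m) (Fin k) ℂ) :
    MvPolynomial.eval (fun x : Fin m × Fin k => A x.1 x.2)
      (Matrix.of fun a b : Fin k => (MvPolynomial.X (I.1.orderEmbOfFin I.2 a, b) :
        MvPolynomial (Fin m × Fin k) ℂ)).det = plucker I A := by
  unfold plucker
  rw [RingHom.map_det]
  congr 1
  ext a b
  rw [RingHom.mapMatrix_apply, Matrix.map_apply, Matrix.of_apply, MvPolynomial.eval_X]
  rfl

/-- `p_I²`, as a global section of `O(2)` on `OG(k,m)`. -/
def pluckerSq {k m : ℕ} (I : {I : Finset (Fin m) // I.card = k}) : sections k m 2 :=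
  ⟨fun A => plucker I A.1 ^ 2, by
    refine ⟨fun A => ⟨(Matrix.of fun a b : Fin k =>
      (MvPolynomial.X (I.1.orderEmbOfFin I.2 a, b) : MvPolynomial (Fin m × Fin k) ℂ)).det ^ 2,
      1, by rw [map_one]; exact one_ne_zero, ?_⟩, ?_⟩
    · intro B _
      rw [map_pow, plucker_eq_eval, map_one, div_one]
    · intro A B g h
      change plucker I B.1 ^ 2 = g.det ^ 2 * plucker I A.1 ^ 2
      rw [h, plucker_mul, mul_pow]⟩

/-- The Plücker coordinates are permuted by `S_m` up to sign, their squares exactly. -/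
lemma sectionsRep_pluckerSq {k m : ℕ} (σ : Equiv.Perm (Fin m))
    (I J : {I : Finset (Fin m) // I.card = k}) (h : J.1 = I.1.map σ.toEmbedding) :
    sectionsRep k m 2 σ (pluckerSq I) = pluckerSq J := by
  apply Subtype.ext
  funext A
  change plucker I (A.1.submatrix σ id) ^ 2 = plucker J A.1 ^ 2
  have hmem : ∀ a, ∃ b, J.1.orderEmbOfFin J.2 b = σ (I.1.orderEmbOfFin I.2 a) := by
    intro a
    have : σ (I.1.orderEmbOfFin I.2 a) ∈ Set.range (J.1.orderEmbOfFin J.2) := by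
      rw [Finset.range_orderEmbOfFin, h]
      simp
    exact this
  choose t ht using hmem
  have htinj : Function.Injective t := by
    intro a b hab
    have := (ht a).symm.trans ((congrArg _ hab).trans (ht b))
    exact (I.1.orderEmbOfFin I.2).injective (σ.injective this)
  let τ : Equiv.Perm (Fin k) := Equiv.ofBijective t (Finite.injective_iff_bijective.1 htinj)
  have e : (A.1.submatrix σ id).submatrix (I.1.orderEmbOfFin I.2) id =
      (A.1.submatrix (J.1.orderEmbOfFin J.2) id).submatrix τ id := by
    ext a b
    simp only [Matrix.submatrix_apply, id]
    rw [← ht a]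
    rfl
  unfold plucker
  rw [e, Matrix.det_permute, mul_pow]
  have : ((Equiv.Perm.sign τ : ℤ) : ℂ) ^ 2 = 1 := by
    rcases Int.units_eq_one_or (Equiv.Perm.sign τ) with h | h <;> rw [h] <;> simp
  rw [this, one_mul]

/-! ### The map `ρ_{m,k}` -/

/-- The exponent of the monomial `α_I`. -/
def sfExp {m : ℕ} (I : Finset (Fin m)) : Fin m →₀ ℕ := ∑ i ∈ I, Finsupp.single i 1

/-- The linear map underlying `ρ_{m,k}`: in `∑_I c_I α_I`, each `α_I` is replaced by `p_I²`. -/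
def rhoLin (m k : ℕ) : (SF m k).toSubmodule →ₗ[ℂ] sections k m 2 where
  toFun f := ∑ I : {I : Finset (Fin m) // I.card = k},
    MvPolynomial.coeff (sfExp I.1) f.1 • pluckerSq I
  map_add' f g := by
    simp [add_smul, Finset.sum_add_distrib]
  map_smul' c f := by
    simp [mul_smul, Finset.smul_sum]

lemma sfExp_map {m : ℕ} (σ : Equiv.Perm (Fin m)) (I : Finset (Fin m)) :
    sfExp (I.map σ.toEmbedding) = (sfExp I).mapDomain σ := by
  simp [sfExp, Finsupp.mapDomain_finsetSum, Finsupp.mapDomain_single]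

/-- The `S_m`-equivariant map `ρ_{m,k} : SF_{m,k} → H⁰(OG(k,m), O(2))`. -/
def rho (m k : ℕ) :
    Representation.IntertwiningMap (SF m k).toRepresentation (sectionsRep k m 2) :=
  (rhoLin m k).intertwiningMap_of_isIntertwiningMap _ _ (by
    intro σ f
    change ∑ J : {I : Finset (Fin m) // I.card = k},
        MvPolynomial.coeff (sfExp J.1) (MvPolynomial.rename σ f.1) • pluckerSq J =
      sectionsRep k m 2 σ (∑ I : {I : Finset (Fin m) // I.card = k},
        MvPolynomial.coeff (sfExp I.1) f.1 • pluckerSq I)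
    rw [map_sum]
    symm
    let e : {I : Finset (Fin m) // I.card = k} → {I : Finset (Fin m) // I.card = k} :=
      fun I => ⟨I.1.map σ.toEmbedding, by rw [Finset.card_map, I.2]⟩
    have he : Function.Bijective e := by
      refine Finite.injective_iff_bijective.1 fun I J h => ?_
      exact Subtype.ext (Finset.map_injective _ (congrArg Subtype.val h))
    refine Fintype.sum_bijective e he _ _ fun I => ?_
    rw [map_smul, sectionsRep_pluckerSq σ I (e I) rfl]
    congr 1
    change _ = MvPolynomial.coeff (sfExp (I.1.map σ.toEmbedding)) _
    rw [sfExp_map, MvPolynomial.coeff_rename_mapDomain _ σ.injective])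

end CobleOG

end

open CobleOG

/-! The relations come from isotropy. Fix `J` with `|J| = k - 1` and an isotropic frame `A`. Laplace
expansion along the row `a` of the minor on the rows `a, J` shows that these minors, as `a` varies,
form a vector of the column span of `A`. The sum of their squares is therefore zero
(`sum_det_cons_sq_eq_zero`), and ρ kills `raisingSpan`, the span of the polynomials `α_J ∑ α_a`.

Modulo `raisingSpan`, averaging turns every square-free monomial into a combination of products of
`k` differences in distinct variables (`SF_le_pairSpan_sup_raisingSpan`). These products span the
Specht module (`specht_twoRow_toSubmodule`), so ρ maps it onto the whole image.

The Specht module is irreducible (`isIrreducible_specht_twoRow`) because the antisymmetrizer of `k`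
disjoint pairs maps `SF_{m,k}` into a line. By Schur's lemma ρ is injective or zero on it, and it is
not zero because some `p_I` is nonzero on an explicit isotropic subspace
(`exists_pluckerSq_ne_zero`). No dimension has to be counted. -/

namespace CobleOG

open MvPolynomial

variable {m : ℕ}

/-! ### Products of differences of distinct variables -/

/-- The indices occurring in a list of pairs. -/
def entries (L : List (Fin m × Fin m)) : List (Fin m) := L.flatMap fun p => [p.1, p.2]

@[simp] lemma entries_nil : entries ([] : List (Fin m × Fin m)) = [] := rfl

@[simp] lemma entries_cons (p : Fin m × Fin m) (L : List (Fin m × Fin m)) :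
    entries (p :: L) = p.1 :: p.2 :: entries L := rfl

/-- The product of the differences `α_a - α_b` over a list of pairs `(a, b)`. -/
noncomputable def pairProd (L : List (Fin m × Fin m)) : MvPolynomial (Fin m) ℂ :=
  (L.map fun p => (X p.1 - X p.2 : MvPolynomial (Fin m) ℂ)).prod

@[simp] lemma pairProd_nil : pairProd ([] : List (Fin m × Fin m)) = 1 := rfl

@[simp] lemma pairProd_cons (p : Fin m × Fin m) (L : List (Fin m × Fin m)) :
    pairProd (p :: L) = (X p.1 - X p.2) * pairProd L := by simp [pairProd]

lemma pairProd_ne_zero : ∀ {L : List (Fin m × Fin m)}, (entries L).Nodup → pairProd L ≠ 0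
  | [], _ => by simp
  | (a, b) :: L, h => by
    simp only [entries_cons, List.nodup_cons, List.mem_cons, not_or] at h
    rw [pairProd_cons]
    exact mul_ne_zero (sub_ne_zero.2 fun e => h.1.1 (X_injective e)) (pairProd_ne_zero h.2.2)

@[simp] lemma sfMonomial_empty : sfMonomial (∅ : Finset (Fin m)) = 1 := rfl

lemma sfMonomial_insert {a : Fin m} {R : Finset (Fin m)} (h : a ∉ R) :
    sfMonomial (insert a R) = X a * sfMonomial R := Finset.prod_insert h

lemma polyRep_mul (σ : Equiv.Perm (Fin m)) (f g : MvPolynomial (Fin m) ℂ) :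
    polyRep m σ (f * g) = polyRep m σ f * polyRep m σ g :=
  map_mul (rename (R := ℂ) σ) f g

lemma polyRep_X (σ : Equiv.Perm (Fin m)) (i : Fin m) : polyRep m σ (X i) = X (σ i) :=
  rename_X _ _

lemma polyRep_pairProd (σ : Equiv.Perm (Fin m)) (L : List (Fin m × Fin m))
    (h : ∀ x ∈ entries L, σ x = x) : polyRep m σ (pairProd L) = pairProd L := by
  induction L with
  | nil => exact map_one (rename (R := ℂ) σ)
  | cons p L ih =>
    simp only [entries_cons, List.mem_cons, forall_eq_or_imp] at h
    rw [pairProd_cons, polyRep_mul, ih h.2.2, map_sub, polyRep_X, polyRep_X, h.1, h.2.1]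

lemma polyRep_sfMonomial_of_forall (σ : Equiv.Perm (Fin m)) (R : Finset (Fin m))
    (h : ∀ x ∈ R, σ x = x) : polyRep m σ (sfMonomial R) = sfMonomial R := by
  change rename σ (sfMonomial R) = _
  simp only [sfMonomial, map_prod, rename_X]
  exact Finset.prod_congr rfl fun x hx => by rw [h x hx]

lemma sfMonomial_mem_SF {k : ℕ} {I : Finset (Fin m)} (h : I.card = k) :
    sfMonomial I ∈ (SF m k).toSubmodule := Submodule.subset_span ⟨⟨I, h⟩, rfl⟩

/-- Expand one difference at a time: either `a` or `b` joins `R`, and disjointness keeps every term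
square-free. -/
lemma pairProd_mul_sfMonomial_mem_SF {k : ℕ} {L : List (Fin m × Fin m)} (hL : (entries L).Nodup)
    {R : Finset (Fin m)} (hR : ∀ x ∈ entries L, x ∉ R) (hk : L.length + R.card = k) :
    pairProd L * sfMonomial R ∈ (SF m k).toSubmodule := by
  induction L generalizing R with
  | nil => simpa using sfMonomial_mem_SF (by simpa using hk)
  | cons p L ih =>
    obtain ⟨a, b⟩ := p
    simp only [entries_cons, List.nodup_cons, List.mem_cons, not_or, forall_eq_or_imp,
      List.length_cons] at hL hR hk
    have key : pairProd ((a, b) :: L) * sfMonomial R =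
        pairProd L * sfMonomial (insert a R) - pairProd L * sfMonomial (insert b R) := by
      rw [sfMonomial_insert hR.1, sfMonomial_insert hR.2.1, pairProd_cons]; ring
    rw [key]
    refine Submodule.sub_mem _ (ih hL.2.2 ?_ ?_) (ih hL.2.2 ?_ ?_)
    · grind
    · rw [Finset.card_insert_of_notMem hR.1]; omega
    · grind
    · rw [Finset.card_insert_of_notMem hR.2.1]; omega

/-! ### Decomposition of `SF_{m,k}` modulo the raising relations -/

/-- The span in `SF_{m,k}` of the polynomials `α_J ∑_{a ∉ J} α_a` with `|J| + 1 = k`. -/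
noncomputable def raisingSpan (m k : ℕ) : Submodule ℂ (MvPolynomial (Fin m) ℂ) :=
  Submodule.span ℂ (Set.range fun J : {J : Finset (Fin m) // J.card + 1 = k} =>
    sfMonomial J.1 * ∑ a ∈ J.1ᶜ, X a)

/-- With `s = ∑_{C} α`, one has `(α_a - α_b) s = α_a (s + α_b) - α_b (s + α_a)`. When the pair is
dissolved and one of its indices joins `R`, the other joins the complement `C`. -/
lemma pairProd_mul_sum_mem_raisingSpan {k : ℕ} {L : List (Fin m × Fin m)}
    (hL : (entries L).Nodup) {R C : Finset (Fin m)} (hR : ∀ x ∈ entries L, x ∉ R)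
    (hC : ∀ x, x ∈ C ↔ x ∉ entries L ∧ x ∉ R) (hk : L.length + R.card + 1 = k) :
    pairProd L * sfMonomial R * ∑ a ∈ C, X a ∈ raisingSpan m k := by
  induction L generalizing R C with
  | nil =>
    have : C = Rᶜ := by ext x; simp [hC]
    subst this
    exact Submodule.subset_span ⟨⟨R, by simpa using hk⟩, by simp⟩
  | cons p L ih =>
    obtain ⟨a, b⟩ := p
    simp only [entries_cons, List.nodup_cons, List.mem_cons, not_or, forall_eq_or_imp,
      List.length_cons] at hL hR hk hC
    have ha : a ∉ C := by grind
    have hb : b ∉ C := by grind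
    have key : pairProd ((a, b) :: L) * sfMonomial R * ∑ a ∈ C, X a =
        pairProd L * sfMonomial (insert a R) * ∑ a ∈ insert b C, X a -
          pairProd L * sfMonomial (insert b R) * ∑ a ∈ insert a C, X a := by
      rw [sfMonomial_insert hR.1, sfMonomial_insert hR.2.1, pairProd_cons,
        Finset.sum_insert ha, Finset.sum_insert hb]
      ring
    rw [key]
    refine Submodule.sub_mem _ (ih hL.2.2 ?_ ?_ ?_) (ih hL.2.2 ?_ ?_ ?_)
    · grind
    · grind
    · rw [Finset.card_insert_of_notMem hR.1]; omega
    · grind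
    · grind
    · rw [Finset.card_insert_of_notMem hR.2.1]; omega

/-- The span of the products of `k` differences of distinct variables. -/
noncomputable def pairSpan (m k : ℕ) : Submodule ℂ (MvPolynomial (Fin m) ℂ) :=
  Submodule.span ℂ
    (Set.range fun L : {L : List (Fin m × Fin m) // (entries L).Nodup ∧ L.length = k} =>
      pairProd L.1)

/-- Induction on `|R|`, trading an index `r` of `R` for a new pair: `|C| α_r = ∑_{b ∈ C} α_b + ∑_{b
∈ C} (α_r - α_b)`. The first sum gives a raising relation, the second gives terms with one more pair
and one index fewer in `R`. -/
lemma pairProd_mul_sfMonomial_mem_sup {k : ℕ} (n : ℕ) {L : List (Fin m × Fin m)}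
    (hL : (entries L).Nodup) {R : Finset (Fin m)} (hR : ∀ x ∈ entries L, x ∉ R)
    (hn : R.card = n) (hk : L.length + R.card = k) :
    pairProd L * sfMonomial R ∈ pairSpan m k ⊔ raisingSpan m k := by
  induction n generalizing L R with
  | zero =>
    rw [Finset.card_eq_zero] at hn
    subst hn
    refine Submodule.mem_sup_left (Submodule.subset_span ⟨⟨L, hL, by simpa using hk⟩, ?_⟩)
    simp
  | succ n ih =>
    obtain ⟨r, S, hr, rfl, hS⟩ := Finset.card_eq_succ.1 hn
    -- The complement is taken with respect to `S`, so it contains `r`; hence `|C| ≠ 0` and can be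
    -- divided out.
    let C : Finset (Fin m) := {x | x ∉ entries L ∧ x ∉ S}
    have hC : ∀ x, x ∈ C ↔ x ∉ entries L ∧ x ∉ S := by simp [C]
    have hrC : r ∈ C := by grind
    have h1 : pairProd L * sfMonomial S * ∑ a ∈ C, X a ∈ pairSpan m k ⊔ raisingSpan m k :=
      Submodule.mem_sup_right
        (pairProd_mul_sum_mem_raisingSpan hL (by grind) hC (by omega))
    have h2 : ∑ b ∈ C, (pairProd L * sfMonomial S * (X r - X b)) ∈
        pairSpan m k ⊔ raisingSpan m k := by
      refine Submodule.sum_mem _ fun b hb => ?_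
      by_cases hbr : b = r
      · simp [hbr]
      · have := ih (L := (r, b) :: L) (R := S) (by simp; grind) (by simp; grind) hS
          (by rw [List.length_cons]; omega)
        convert this using 1
        rw [pairProd_cons]; ring
    have h3 : ((C.card : ℂ)) • (pairProd L * sfMonomial (insert r S)) ∈
        pairSpan m k ⊔ raisingSpan m k := by
      convert Submodule.add_mem _ h1 h2 using 1
      rw [← Finset.mul_sum, ← mul_add, Finset.sum_sub_distrib, add_sub_cancel, Finset.sum_const,
        sfMonomial_insert hr, ← Nat.cast_smul_eq_nsmul ℂ, mul_smul_comm]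
      congr 1; ring
    exact (Submodule.smul_mem_iff _
      (Nat.cast_ne_zero.2 (Finset.card_ne_zero_of_mem hrC))).1 h3

theorem SF_le_pairSpan_sup_raisingSpan (m k : ℕ) :
    (SF m k).toSubmodule ≤ pairSpan m k ⊔ raisingSpan m k := by
  refine Submodule.span_le.2 ?_
  rintro _ ⟨I, rfl⟩
  simpa using pairProd_mul_sfMonomial_mem_sup (k := k) I.1.card (L := []) (by simp) (R := I.1)
    (by simp) rfl (by simp [I.2])

/-! ### Antisymmetrizers of disjoint pairs -/

/-- The product of the operators `1 - (a b)` over a list of pairs `(a, b)`. -/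
noncomputable def pairAntisymm (L : List (Fin m × Fin m)) :
    Module.End ℂ (MvPolynomial (Fin m) ℂ) :=
  (L.map fun p => 1 - polyRep m (Equiv.swap p.1 p.2)).prod

@[simp] lemma pairAntisymm_nil (f : MvPolynomial (Fin m) ℂ) : pairAntisymm [] f = f := rfl

@[simp] lemma pairAntisymm_cons (p : Fin m × Fin m) (L : List (Fin m × Fin m))
    (f : MvPolynomial (Fin m) ℂ) : pairAntisymm (p :: L) f =
      pairAntisymm L f - polyRep m (Equiv.swap p.1 p.2) (pairAntisymm L f) := by
  simp [pairAntisymm]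

lemma pairAntisymm_mem {V : Submodule ℂ (MvPolynomial (Fin m) ℂ)}
    (hV : ∀ σ, ∀ v ∈ V, polyRep m σ v ∈ V) (L : List (Fin m × Fin m)) :
    ∀ v ∈ V, pairAntisymm L v ∈ V := by
  intro v hv
  induction L with
  | nil => simpa
  | cons p L ih => rw [pairAntisymm_cons]; exact V.sub_mem ih (hV _ _ ih)

lemma pairAntisymm_mul {L : List (Fin m × Fin m)} (f g : MvPolynomial (Fin m) ℂ)
    (hf : ∀ p ∈ L, polyRep m (Equiv.swap p.1 p.2) f = f) :
    pairAntisymm L (f * g) = f * pairAntisymm L g := by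
  induction L with
  | nil => rfl
  | cons p L ih =>
    simp only [List.mem_cons, forall_eq_or_imp] at hf
    rw [pairAntisymm_cons, pairAntisymm_cons, ih hf.2, polyRep_mul, hf.1, mul_sub]

lemma mem_entries_of_mem {L : List (Fin m × Fin m)} {p : Fin m × Fin m} (hp : p ∈ L) :
    p.1 ∈ entries L ∧ p.2 ∈ entries L :=
  ⟨List.mem_flatMap.2 ⟨p, hp, by simp⟩, List.mem_flatMap.2 ⟨p, hp, by simp⟩⟩

lemma swap_apply_of_notMem {a b : Fin m} {l : List (Fin m)} (ha : a ∉ l) (hb : b ∉ l) :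
    ∀ x ∈ l, Equiv.swap a b x = x := fun _ hx =>
  Equiv.swap_apply_of_ne_of_ne (fun e => ha (e ▸ hx)) fun e => hb (e ▸ hx)

/-- Each `1 - (a b)` doubles its own factor `α_a - α_b` and fixes the others, the pairs being
disjoint. -/
lemma pairAntisymm_pairProd {L : List (Fin m × Fin m)} (hL : (entries L).Nodup) :
    pairAntisymm L (pairProd L) = (2 : ℂ) ^ L.length • pairProd L := by
  induction L with
  | nil => simp
  | cons p L ih =>
    obtain ⟨a, b⟩ := p
    simp only [entries_cons, List.nodup_cons, List.mem_cons, not_or] at hL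
    have h1 : ∀ p ∈ L, polyRep m (Equiv.swap p.1 p.2) (X a - X b) = X a - X b := by
      intro p hp
      have := mem_entries_of_mem hp
      rw [map_sub, polyRep_X, polyRep_X, Equiv.swap_apply_of_ne_of_ne,
        Equiv.swap_apply_of_ne_of_ne] <;> grind
    rw [pairProd_cons, pairAntisymm_cons, pairAntisymm_mul _ _ h1, ih hL.2.2, polyRep_mul, map_smul,
      polyRep_pairProd _ _ (swap_apply_of_notMem hL.1.2 hL.2.1), map_sub, polyRep_X, polyRep_X]
    simp only [Equiv.swap_apply_left, Equiv.swap_apply_right, List.length_cons, pow_succ, mul_smul,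
      two_smul ℂ, mul_smul_comm]
    rw [← smul_sub]
    congr 1; ring

/-- The operator `1 - (a b)` kills `α_R` when `R` contains both or neither of `a`, `b`. Otherwise it
replaces the one present by `±(α_a - α_b)`, so each pair uses up exactly one index. -/
lemma pairAntisymm_sfMonomial {L : List (Fin m × Fin m)} (hL : (entries L).Nodup)
    (K : Finset (Fin m)) : pairAntisymm L (sfMonomial K) = 0 ∨
      ∃ (c : ℂ) (R : Finset (Fin m)), (∀ x ∈ entries L, x ∉ R) ∧ R.card + L.length = K.card ∧
        pairAntisymm L (sfMonomial K) = c • (pairProd L * sfMonomial R) := by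
  induction L with
  | nil => exact Or.inr ⟨1, K, by simp, by simp, by simp⟩
  | cons p L ih =>
    obtain ⟨a, b⟩ := p
    simp only [entries_cons, List.nodup_cons, List.mem_cons, not_or] at hL
    have hP := polyRep_pairProd _ _ (swap_apply_of_notMem hL.1.2 hL.2.1)
    rw [pairAntisymm_cons]
    rcases ih hL.2.2 with h | ⟨c, R, hR, hc, h⟩
    · left; simp [h]
    rw [h, map_smul, polyRep_mul, hP, ← smul_sub, ← mul_sub]
    by_cases ha : a ∈ R <;> by_cases hb : b ∈ R
    · left
      have : polyRep m (Equiv.swap a b) (sfMonomial R) = sfMonomial R := by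
        rw [polyRep_sfMonomial]
        congr 1
        ext x
        simp only [Finset.mem_map_equiv, Equiv.symm_swap]
        rcases eq_or_ne x a with rfl | hxa
        · simp [ha, hb]
        rcases eq_or_ne x b with rfl | hxb
        · simp [ha, hb]
        rw [Equiv.swap_apply_of_ne_of_ne hxa hxb]
      rw [this]; simp
    · right
      obtain ⟨S, hS, rfl⟩ : ∃ S, a ∉ S ∧ R = insert a S :=
        ⟨R.erase a, by simp, by simp [Finset.insert_erase ha]⟩
      rw [Finset.card_insert_of_notMem hS] at hc
      refine ⟨c, S, by simp; grind, by rw [List.length_cons]; omega, ?_⟩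
      rw [sfMonomial_insert hS, polyRep_mul, polyRep_X, Equiv.swap_apply_left,
        polyRep_sfMonomial_of_forall _ S fun x hx =>
          Equiv.swap_apply_of_ne_of_ne (by grind) (by grind), pairProd_cons]
      congr 1; ring
    · right
      obtain ⟨S, hS, rfl⟩ : ∃ S, b ∉ S ∧ R = insert b S :=
        ⟨R.erase b, by simp, by simp [Finset.insert_erase hb]⟩
      rw [Finset.card_insert_of_notMem hS] at hc
      refine ⟨-c, S, by simp; grind, by rw [List.length_cons]; omega, ?_⟩
      rw [sfMonomial_insert hS, polyRep_mul, polyRep_X, Equiv.swap_apply_right,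
        polyRep_sfMonomial_of_forall _ S fun x hx =>
          Equiv.swap_apply_of_ne_of_ne (by grind) (by grind), pairProd_cons, neg_smul, ← smul_neg]
      congr 1; ring
    · left
      rw [polyRep_sfMonomial_of_forall _ R fun x hx =>
          Equiv.swap_apply_of_ne_of_ne (by grind) (by grind)]
      simp

/-- In degree `|L|` the pairs use up every index, leaving `R = ∅`. -/
lemma pairAntisymm_mem_span_pairProd {L : List (Fin m × Fin m)} (hL : (entries L).Nodup)
    {f : MvPolynomial (Fin m) ℂ} (hf : f ∈ (SF m L.length).toSubmodule) :
    pairAntisymm L f ∈ ℂ ∙ pairProd L := by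
  have : (SF m L.length).toSubmodule ≤ (ℂ ∙ pairProd L).comap (pairAntisymm L) := by
    refine Submodule.span_le.2 ?_
    rintro _ ⟨I, rfl⟩
    change pairAntisymm L (sfMonomial I.1) ∈ Submodule.span ℂ {pairProd L}
    rcases pairAntisymm_sfMonomial hL I.1 with h | ⟨c, R, -, hc, h⟩
    · rw [h]; exact zero_mem _
    · have : R = ∅ := by rw [← Finset.card_eq_zero]; have := I.2; omega
      rw [h, this, sfMonomial_empty, mul_one]
      exact Submodule.smul_mem _ _ (Submodule.mem_span_singleton_self _)
  exact this hf

/-! ### Identification of the span of pair products with the Specht module -/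

lemma polyRep_pairProd_eq (σ : Equiv.Perm (Fin m)) (L : List (Fin m × Fin m)) :
    polyRep m σ (pairProd L) = pairProd (L.map (Prod.map σ σ)) := by
  induction L with
  | nil => exact map_one (rename (R := ℂ) σ)
  | cons p L ih =>
    rw [List.map_cons, pairProd_cons, pairProd_cons, polyRep_mul, ih, map_sub, polyRep_X,
      polyRep_X]
    rfl

lemma entries_map (σ : Fin m → Fin m) (L : List (Fin m × Fin m)) :
    entries (L.map (Prod.map σ σ)) = (entries L).map σ := by
  induction L with
  | nil => rfl
  | cons p L ih => simp [ih]

lemma length_entries (L : List (Fin m × Fin m)) : (entries L).length = 2 * L.length := by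
  induction L with
  | nil => rfl
  | cons p L ih => simp [ih]; ring

lemma entries_injective : Function.Injective (entries (m := m)) := by
  intro L L' h
  induction L generalizing L' with
  | nil => cases L' with
    | nil => rfl
    | cons p L' => simp at h
  | cons p L ih => cases L' with
    | nil => simp at h
    | cons q L' =>
      simp only [entries_cons, List.cons.injEq] at h
      rw [ih h.2.2, Prod.ext h.1 h.2.1]

lemma exists_perm_map_eq {α : Type*} [Finite α] {l l' : List α} (hl : l.Nodup) (hl' : l'.Nodup)
    (h : l.length = l'.length) : ∃ σ : Equiv.Perm α, l.map σ = l' := by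
  let x : Fin l.length ↪ α := ⟨l.get, List.nodup_iff_injective_get.1 hl⟩
  let y : Fin l.length ↪ α := ⟨fun i => l'.get (i.cast h),
    (List.nodup_iff_injective_get.1 hl').comp (Fin.cast_injective h)⟩
  obtain ⟨σ, hσ⟩ := (Equiv.Perm.isMultiplyPretransitive α l.length).exists_smul_eq x y
  refine ⟨σ, List.ext_get (by simp [h]) fun n h1 h2 => ?_⟩
  have := DFunLike.congr_fun hσ ⟨n, by simpa using h1⟩
  simpa [x, y] using this

/-- `S_m` is transitive on lists of distinct indices of a given length, and the flattened list
determines the pairs. A stable subspace containing one pair product thus contains all those with as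
many pairs. -/
lemma exists_polyRep_pairProd_eq {L L' : List (Fin m × Fin m)} (hL : (entries L).Nodup)
    (hL' : (entries L').Nodup) (h : L.length = L'.length) :
    ∃ σ, polyRep m σ (pairProd L) = pairProd L' := by
  obtain ⟨σ, hσ⟩ := exists_perm_map_eq hL hL' (by rw [length_entries, length_entries, h])
  rw [← entries_map] at hσ
  exact ⟨σ, by rw [polyRep_pairProd_eq, entries_injective hσ]⟩

lemma mem_twoRow {k : ℕ} {h : 2 * k ≤ m} {c : ℕ × ℕ} :
    c ∈ (twoRow m k h).cells ↔ c.1 = 0 ∧ c.2 < m - k ∨ c.1 = 1 ∧ c.2 < k := by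
  obtain ⟨i, j⟩ := c
  rw [YoungDiagram.mem_cells, twoRow, YoungDiagram.mem_ofRowLens]
  rcases i with _ | _ | i <;> simp

lemma card_twoRow {k : ℕ} (h : 2 * k ≤ m) : (twoRow m k h).cells.card = m := by
  have : (twoRow m k h).cells = {0} ×ˢ Finset.range (m - k) ∪ {1} ×ˢ Finset.range k := by
    ext ⟨i, j⟩
    rw [mem_twoRow]
    simp only [Finset.mem_union, Finset.mem_product, Finset.mem_singleton, Finset.mem_range]
  rw [this, Finset.card_union_of_disjoint]
  · simp; omega
  · rw [Finset.disjoint_left]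
    rintro ⟨i, j⟩ h0 h1
    simp only [Finset.mem_product, Finset.mem_singleton] at h0 h1
    omega

/-- The `j`-th box of the first row. -/
def topBox {k : ℕ} (h : 2 * k ≤ m) (j : Fin k) : (twoRow m k h).cells :=
  ⟨(0, j), mem_twoRow.2 (Or.inl ⟨rfl, by have := j.2; simp; omega⟩)⟩

/-- The `j`-th box of the second row. -/
def bottomBox {k : ℕ} (h : 2 * k ≤ m) (j : Fin k) : (twoRow m k h).cells :=
  ⟨(1, j), mem_twoRow.2 (Or.inr ⟨rfl, j.2⟩)⟩

/-- The pairs of entries of a numbering that lie in a common column. -/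
def columnPairs {k : ℕ} (h : 2 * k ≤ m) (T : (twoRow m k h).cells ≃ Fin m) :
    List (Fin m × Fin m) :=
  List.ofFn fun j : Fin k => (T (topBox h j), T (bottomBox h j))

lemma length_columnPairs {k : ℕ} (h : 2 * k ≤ m) (T : (twoRow m k h).cells ≃ Fin m) :
    (columnPairs h T).length = k := by simp [columnPairs]

lemma nodup_columnPairs {k : ℕ} (h : 2 * k ≤ m) (T : (twoRow m k h).cells ≃ Fin m) :
    (entries (columnPairs h T)).Nodup := by
  rw [entries, List.nodup_flatMap]
  constructor
  · intro p hp
    obtain ⟨j, rfl⟩ := List.mem_ofFn.1 hp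
    simp [topBox, bottomBox]
  · rw [columnPairs, List.pairwise_ofFn]
    intro i j hij
    simp [topBox, bottomBox, Fin.val_inj, hij.ne']

/-- Only the first `k` columns have two boxes; the other columns contribute no factor. -/
lemma spechtPoly_eq_pairProd {k : ℕ} (h : 2 * k ≤ m) (T : (twoRow m k h).cells ≃ Fin m) :
    spechtPoly (twoRow m k h) T = pairProd (columnPairs h T) := by
  rw [pairProd, columnPairs, List.map_ofFn, List.prod_ofFn, spechtPoly]
  symm
  refine Finset.prod_bij (fun j _ => (topBox h j, bottomBox h j)) ?_ ?_ ?_ ?_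
  · intro j _
    simp [topBox, bottomBox]
  · intro i _ j _ hij
    simpa [topBox, bottomBox, Fin.val_inj] using hij
  · rintro ⟨⟨⟨i, j⟩, hc⟩, ⟨i', j'⟩, hd⟩ hcd
    simp only [Finset.mem_filter_univ] at hcd
    obtain ⟨rfl, hlt⟩ := hcd
    have hc' := mem_twoRow.1 hc
    have hd' := mem_twoRow.1 hd
    simp only at hc' hd' hlt
    obtain ⟨rfl, rfl, hj⟩ : i = 0 ∧ i' = 1 ∧ j < k := by omega
    exact ⟨⟨j, hj⟩, Finset.mem_univ _, rfl⟩
  · intro j _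
    rfl

lemma specht_twoRow_toSubmodule {k : ℕ} (h : 2 * k ≤ m) :
    (specht m (twoRow m k h)).toSubmodule = pairSpan m k := by
  apply le_antisymm
  · refine Submodule.span_le.2 ?_
    rintro _ ⟨T, rfl⟩
    refine Submodule.subset_span ⟨⟨columnPairs h T, nodup_columnPairs h T,
      length_columnPairs h T⟩, ?_⟩
    exact (spechtPoly_eq_pairProd h T).symm
  · refine Submodule.span_le.2 ?_
    rintro _ ⟨⟨L, hL, hk⟩, rfl⟩
    -- Any numbering will do: a permutation carries its column pairs to `L`, which avoids extending
    -- `L` to a full numbering.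
    let T : (twoRow m k h).cells ≃ Fin m := Finset.equivFinOfCardEq (card_twoRow h)
    obtain ⟨σ, hσ⟩ := exists_polyRep_pairProd_eq (nodup_columnPairs h T) hL
      (by rw [length_columnPairs, hk])
    change pairProd L ∈ (specht m (twoRow m k h)).toSubmodule
    rw [← hσ]
    refine (specht m (twoRow m k h)).apply_mem_toSubmodule σ (Submodule.subset_span ⟨T, ?_⟩)
    exact spechtPoly_eq_pairProd h T

/-! ### Irreducibility of the Specht module -/

lemma pairSpan_le_SF (m k : ℕ) : pairSpan m k ≤ (SF m k).toSubmodule := by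
  refine Submodule.span_le.2 ?_
  rintro _ ⟨⟨L, hL, hk⟩, rfl⟩
  simpa using pairProd_mul_sfMonomial_mem_SF hL (R := ∅) (by simp) (by simpa using hk)

/-- James's submodule theorem: a stable subspace of `SF_{m,k}` contains the Specht module
or is killed by all antisymmetrizers. -/
lemma pairSpan_le_or_pairAntisymm_eq_zero {k : ℕ} {V : Submodule ℂ (MvPolynomial (Fin m) ℂ)}
    (hV : ∀ σ, ∀ v ∈ V, polyRep m σ v ∈ V) (hSF : V ≤ (SF m k).toSubmodule) :
    pairSpan m k ≤ V ∨ ∀ L : List (Fin m × Fin m), (entries L).Nodup → L.length = k →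
      ∀ v ∈ V, pairAntisymm L v = 0 := by
  by_contra! hcon
  obtain ⟨hle, L, hL, rfl, v, hv, hne⟩ := hcon
  obtain ⟨c, hc⟩ := Submodule.mem_span_singleton.1 (pairAntisymm_mem_span_pairProd hL (hSF hv))
  have hc0 : c ≠ 0 := by
    rintro rfl
    exact hne (by rw [← hc, zero_smul])
  have hLV : pairProd L ∈ V :=
    (V.smul_mem_iff hc0).1 (hc ▸ pairAntisymm_mem hV L v hv)
  refine hle (Submodule.span_le.2 ?_)
  rintro _ ⟨⟨L', hL', hk⟩, rfl⟩
  obtain ⟨σ, hσ⟩ := exists_polyRep_pairProd_eq hL hL' hk.symm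
  change pairProd L' ∈ V
  exact hσ ▸ hV σ _ hLV

theorem isIrreducible_specht_twoRow {k : ℕ} (h : 2 * k ≤ m) :
    (specht m (twoRow m k h)).toRepresentation.IsIrreducible := by
  set S := specht m (twoRow m k h)
  have hS : S.toSubmodule = pairSpan m k := specht_twoRow_toSubmodule h
  obtain ⟨L, hL, hk⟩ : ∃ L : List (Fin m × Fin m), (entries L).Nodup ∧ L.length = k :=
    ⟨_, nodup_columnPairs h (Finset.equivFinOfCardEq (card_twoRow h)), length_columnPairs _ _⟩
  have hLS : pairProd L ∈ S.toSubmodule := hS ▸ Submodule.subset_span ⟨⟨L, hL, hk⟩, rfl⟩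
  have key (V : Subrepresentation S.toRepresentation) :
      V = ⊤ ∨ ∀ v ∈ V, pairAntisymm L v.1 = 0 := by
    rcases pairSpan_le_or_pairAntisymm_eq_zero (k := k)
      (V := V.toSubmodule.map S.toSubmodule.subtype)
      (by
        rintro σ _ ⟨v, hv, rfl⟩
        exact ⟨_, V.apply_mem_toSubmodule σ hv, rfl⟩)
      (by
        rintro _ ⟨v, -, rfl⟩
        exact pairSpan_le_SF m k (hS.le v.2)) with hV | hV
    · left
      apply Subrepresentation.toSubmodule_injective
      refine (Submodule.eq_top_iff'.2 fun x => ?_)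
      obtain ⟨y, hy, hyx⟩ := hV (hS.le x.2)
      exact (Subtype.ext hyx : y = x) ▸ hy
    · exact Or.inr fun v hv => hV L hL hk v.1 ⟨v, hv, rfl⟩
  have hne : pairAntisymm L (pairProd L) ≠ 0 := by
    rw [pairAntisymm_pairProd hL]
    exact smul_ne_zero (pow_ne_zero _ two_ne_zero) (pairProd_ne_zero hL)
  refine { exists_pair_ne := ⟨⊥, ⊤, fun e => ?_⟩, eq_bot_or_eq_top := fun V => ?_ }
  · have h0 : (⟨pairProd L, hLS⟩ : S.toSubmodule) ∈ (⊥ : Submodule ℂ S.toSubmodule) := by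
      have := congrArg Subrepresentation.toSubmodule e
      change ⊥ = ⊤ at this
      rw [this]
      trivial
    exact pairProd_ne_zero hL (congrArg Subtype.val ((Submodule.mem_bot ℂ).1 h0))
  -- An invariant complement (Maschke) replaces the invariant inner product of James's argument: the
  -- antisymmetrizer cannot kill both summands, since it does not kill `pairProd L`.
  · obtain ⟨W, hW⟩ := exists_isCompl V
    rcases key V with hV | hV
    · exact Or.inr hV
    rcases key W with hW' | hW'
    · left
      exact eq_bot_of_isCompl_top (hW' ▸ hW)
    · exfalso
      have : (⟨pairProd L, hLS⟩ : S.toSubmodule) ∈ (V ⊔ W).toSubmodule := by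
        rw [hW.sup_eq_top]; trivial
      obtain ⟨v, hv, w, hw, hvw⟩ := Submodule.mem_sup.1 this
      have e : v.1 + w.1 = pairProd L := congrArg Subtype.val hvw
      rw [← e, map_add, hV v hv, hW' w hw, add_zero] at hne
      exact hne rfl

/-! ### The map ρ and the raising relations -/

lemma sfExp_injective : Function.Injective (sfExp (m := m)) := by
  have key (I : Finset (Fin m)) (a : Fin m) : sfExp I a = if a ∈ I then 1 else 0 := by
    simp [sfExp, Finsupp.finsetSum_apply, Finsupp.single_apply]
  intro I J h
  ext a
  have := DFunLike.congr_fun h a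
  rw [key, key] at this
  grind

lemma sfMonomial_eq_monomial (I : Finset (Fin m)) : sfMonomial I = monomial (sfExp I) 1 := by
  rw [sfMonomial, sfExp, monomial_sum_one]
  rfl

/-- The linear map `f ↦ ∑_I c_I(f) p_I²`, where `c_I(f)` is the coefficient of `α_I` in `f`. -/
noncomputable def rhoPoly (m k : ℕ) : MvPolynomial (Fin m) ℂ →ₗ[ℂ] sections k m 2 :=
  ∑ I : {I : Finset (Fin m) // I.card = k}, (lcoeff ℂ (sfExp I.1)).smulRight (pluckerSq I)

/-- Passing to a map on all polynomials lets sums be split without carrying membership proofs. -/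
lemma rho_apply {k : ℕ} (f : (SF m k).toSubmodule) : rho m k f = rhoPoly m k f.1 := by
  change ∑ I : {I : Finset (Fin m) // I.card = k}, coeff (sfExp I.1) f.1 • pluckerSq I = _
  simp [rhoPoly]

lemma rhoPoly_sfMonomial {k : ℕ} (I : {I : Finset (Fin m) // I.card = k}) :
    rhoPoly m k (sfMonomial I.1) = pluckerSq I := by
  simp only [rhoPoly, LinearMap.sum_apply, LinearMap.smulRight_apply, lcoeff_apply]
  rw [Finset.sum_eq_single I]
  · simp [sfMonomial_eq_monomial]
  · intro J _ hJ
    rw [sfMonomial_eq_monomial, coeff_monomial, if_neg, zero_smul]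
    exact fun e => hJ (Subtype.ext (sfExp_injective e)).symm
  · simp

/-- Reordering rows changes a minor only by a sign, so `p_I²` can be computed with the rows in any
order, such as `a` followed by `J`. -/
lemma plucker_sq_eq {k : ℕ} (I : {I : Finset (Fin m) // I.card = k}) (f : Fin k → Fin m)
    (hf : Function.Injective f) (hI : ∀ a, f a ∈ I.1) (A : Matrix (Fin m) (Fin k) ℂ) :
    plucker I A ^ 2 = (A.submatrix f id).det ^ 2 := by
  have hmem : ∀ a, ∃ b, I.1.orderEmbOfFin I.2 b = f a := by
    intro a
    have : f a ∈ Set.range (I.1.orderEmbOfFin I.2) := by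
      rw [Finset.range_orderEmbOfFin]; exact hI a
    exact this
  choose t ht using hmem
  have htinj : Function.Injective t := fun a b hab =>
    hf ((ht a).symm.trans ((congrArg _ hab).trans (ht b)))
  let τ : Equiv.Perm (Fin k) := Equiv.ofBijective t (Finite.injective_iff_bijective.1 htinj)
  have e : A.submatrix f id = (A.submatrix (I.1.orderEmbOfFin I.2) id).submatrix τ id := by
    ext a b
    simp only [Matrix.submatrix_apply, id]
    rw [← ht a]
    rfl
  rw [e, Matrix.det_permute, mul_pow, plucker]
  have : ((Equiv.Perm.sign τ : ℤ) : ℂ) ^ 2 = 1 := by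
    rcases Int.units_eq_one_or (Equiv.Perm.sign τ) with h | h <;> rw [h] <;> simp
  rw [this, one_mul]

/-- On an isotropic frame the squares of the maximal minors containing `n` given rows sum
to zero. -/
lemma sum_det_cons_sq_eq_zero {n : ℕ} (A : Matrix (Fin m) (Fin (n + 1)) ℂ)
    (hA : ∀ c d, ∑ i, A i c * A i d = 0) (g : Fin n → Fin m) :
    ∑ a, (A.submatrix (Fin.cons a g : Fin (n + 1) → Fin m) id).det ^ 2 = 0 := by
  -- The cofactors along the first row do not depend on `a`, so the minors form the vector `A u`,
  -- which is isotropic.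
  let u : Fin (n + 1) → ℂ := fun c =>
    (-1) ^ (c : ℕ) * (A.submatrix g (Fin.succAbove c)).det
  have hu (a : Fin m) : (A.submatrix (Fin.cons a g : Fin (n + 1) → Fin m) id).det =
      ∑ c, A a c * u c := by
    rw [Matrix.det_succ_row_zero]
    refine Finset.sum_congr rfl fun c _ => ?_
    have : (A.submatrix (Fin.cons a g : Fin (n + 1) → Fin m) id).submatrix Fin.succ
        (Fin.succAbove c) = A.submatrix g (Fin.succAbove c) := by
      ext i j; simp
    rw [this]
    simp only [Matrix.submatrix_apply, Fin.cons_zero, id, u]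
    ring
  calc ∑ a, (A.submatrix (Fin.cons a g : Fin (n + 1) → Fin m) id).det ^ 2
      = ∑ a, ∑ c, ∑ d, u c * u d * (A a c * A a d) := by
        refine Finset.sum_congr rfl fun a _ => ?_
        rw [hu, sq, Finset.sum_mul_sum]
        exact Finset.sum_congr rfl fun c _ => Finset.sum_congr rfl fun d _ => by ring
    _ = ∑ c, ∑ d, u c * u d * ∑ a, A a c * A a d := by
        rw [Finset.sum_comm]
        refine Finset.sum_congr rfl fun c _ => ?_
        rw [Finset.sum_comm]
        simp only [Finset.mul_sum]
    _ = 0 := by simp [hA]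

lemma sfMonomial_mul_sum {J : Finset (Fin m)} :
    sfMonomial J * ∑ a ∈ Jᶜ, X a = ∑ a ∈ Jᶜ, sfMonomial (insert a J) := by
  rw [Finset.mul_sum]
  refine Finset.sum_congr rfl fun a ha => ?_
  rw [sfMonomial_insert (by simpa using ha), mul_comm]

lemma raisingSpan_le_SF (m k : ℕ) : raisingSpan m k ≤ (SF m k).toSubmodule := by
  refine Submodule.span_le.2 ?_
  rintro _ ⟨J, rfl⟩
  change sfMonomial J.1 * ∑ a ∈ J.1ᶜ, X a ∈ (SF m k).toSubmodule
  rw [sfMonomial_mul_sum]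
  refine Submodule.sum_mem _ fun a ha => sfMonomial_mem_SF ?_
  rw [Finset.card_insert_of_notMem (by simpa using ha), J.2]

lemma rhoPoly_sfMonomial_mul_sum {k : ℕ} (J : Finset (Fin m)) (hJ : J.card + 1 = k) :
    rhoPoly m k (sfMonomial J * ∑ a ∈ Jᶜ, X a) = 0 := by
  subst hJ
  let g : Fin J.card → Fin m := J.orderEmbOfFin rfl
  have hg : ∀ i, g i ∈ J := fun i => J.orderEmbOfFin_mem rfl i
  rw [sfMonomial_mul_sum, map_sum]
  apply Subtype.ext
  funext A
  have hval (a : Fin m) (ha : a ∈ Jᶜ) :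
      (rhoPoly m (J.card + 1) (sfMonomial (insert a J))).1 A =
        (A.1.submatrix (Fin.cons a g : Fin (J.card + 1) → Fin m) id).det ^ 2 := by
    have ha' : a ∉ J := by simpa using ha
    rw [rhoPoly_sfMonomial ⟨insert a J, Finset.card_insert_of_notMem ha'⟩]
    refine plucker_sq_eq _ _ ?_ ?_ _
    · rw [Fin.cons_injective_iff]
      refine ⟨?_, (J.orderEmbOfFin rfl).injective⟩
      rintro ⟨i, hi⟩
      exact ha' (hi ▸ hg i)
    · intro i
      refine Fin.cases ?_ (fun i => ?_) i
      · simp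
      · simpa using Or.inr (hg i)
  rw [AddSubmonoidClass.coe_finsetSum, Finset.sum_apply, Finset.sum_congr rfl hval]
  change _ = (0 : ℂ)
  rw [← sum_det_cons_sq_eq_zero A.1 ((mem_frames_iff _).1 A.2).2 g]
  -- The sum over `a ∉ J` extends to all `a`: for `a ∈ J` the minor has a repeated row.
  refine Finset.sum_subset (Finset.subset_univ _) fun a _ ha => ?_
  have ha' : a ∈ J := by simpa using ha
  obtain ⟨i, hi⟩ : a ∈ Set.range (J.orderEmbOfFin rfl) := by
    rw [Finset.range_orderEmbOfFin]; exact ha'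
  rw [Matrix.det_zero_of_row_eq (i := 0) (j := i.succ) (Fin.succ_ne_zero i).symm, zero_pow two_ne_zero]
  ext c
  simp [g, hi]

lemma rhoPoly_eq_zero_of_mem_raisingSpan {k : ℕ} {f : MvPolynomial (Fin m) ℂ}
    (hf : f ∈ raisingSpan m k) : rhoPoly m k f = 0 := by
  have : raisingSpan m k ≤ LinearMap.ker (rhoPoly m k) := by
    refine Submodule.span_le.2 ?_
    rintro _ ⟨J, rfl⟩
    exact rhoPoly_sfMonomial_mul_sum J.1 J.2
  exact this hf

/-- Some Plücker coordinate is nonzero on some isotropic subspace, because `2k ≤ m`. -/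
lemma exists_pluckerSq_ne_zero {k : ℕ} (h : 2 * k ≤ m) :
    ∃ I : {I : Finset (Fin m) // I.card = k}, pluckerSq I ≠ 0 := by
  -- The bound `2 * k ≤ m` gives two disjoint blocks of `k` coordinates. The columns of `A` are `e_c
  -- + i e_{k+c}`, isotropic because `1 + i² = 0`, and the minor on the first block is that of the
  -- identity.
  let e : Fin k ⊕ Fin k ↪ Fin m := finSumFinEquiv.toEmbedding.trans (Fin.castLEEmb (by omega))
  let A : Matrix (Fin m) (Fin k) ℂ := fun i c =>
    if i = e (Sum.inl c) then 1 else if i = e (Sum.inr c) then Complex.I else 0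
  have hinl (b c : Fin k) : A (e (Sum.inl b)) c = if b = c then 1 else 0 := by simp [A]
  have hinr (b c : Fin k) : A (e (Sum.inr b)) c = if b = c then Complex.I else 0 := by simp [A]
  have hout (i : Fin m) (hi : i ∉ Set.range e) (c : Fin k) : A i c = 0 := by
    simp only [A]
    rw [if_neg, if_neg] <;> rintro rfl <;> exact hi ⟨_, rfl⟩
  have hA : A ∈ frames k m := by
    refine (mem_frames_iff A).2 ⟨?_, fun c d => ?_⟩
    · rw [Fintype.linearIndependent_iff]
      intro x hx c
      have := congrFun hx (e (Sum.inl c))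
      simpa [Matrix.col, hinl] using this
    · rw [← Fintype.sum_of_injective e e.injective (fun s => A (e s) c * A (e s) d) _
        (fun i hi => by simp [hout i hi]) fun _ => rfl, Fintype.sum_sum_type]
      simp only [hinl, hinr, ← Finset.sum_add_distrib]
      refine Finset.sum_eq_zero fun b _ => ?_
      split_ifs <;> simp
  let I : {I : Finset (Fin m) // I.card = k} :=
    ⟨Finset.univ.map (Function.Embedding.inl.trans e), by simp⟩
  refine ⟨I, fun h0 => ?_⟩
  have h1 : plucker I A ^ 2 = 0 := congrFun (congrArg Subtype.val h0) ⟨A, hA⟩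
  rw [plucker_sq_eq I (fun a => e (Sum.inl a)) (fun a b hab => by simpa using hab)
    (fun a => by simp [I])] at h1
  have : A.submatrix (fun a => e (Sum.inl a)) id = 1 := by
    ext b c
    simp [hinl, Matrix.one_apply]
  simp [this] at h1

/-! ### Isomorphism of the Specht module with the image -/

/-- The restriction of `ρ_{m,k}` to the Specht module. -/
noncomputable def rhoSpecht {k : ℕ} (h : 2 * k ≤ m) :
    Representation.IntertwiningMap (specht m (twoRow m k h)).toRepresentation
      (rho m k).range.toRepresentation where
  toLinearMap := ((rho m k).toLinearMap ∘ₗ Submodule.inclusion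
    ((specht_twoRow_toSubmodule h).le.trans (pairSpan_le_SF m k))).codRestrict _
      fun v => LinearMap.mem_range_self _ _
  isIntertwining' σ := by
    apply LinearMap.ext
    intro v
    exact Subtype.ext (Representation.IntertwiningMap.isIntertwining _ _ (rho m k) σ (Submodule.inclusion
      ((specht_twoRow_toSubmodule h).le.trans (pairSpan_le_SF m k)) v))

lemma rhoSpecht_surjective {k : ℕ} (h : 2 * k ≤ m) : Function.Surjective (rhoSpecht h) := by
  rintro ⟨_, f, rfl⟩
  obtain ⟨v, hv, n, hn, hvn⟩ :=
    Submodule.mem_sup.1 (SF_le_pairSpan_sup_raisingSpan m k f.2)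
  refine ⟨⟨v, (specht_twoRow_toSubmodule h).ge hv⟩, Subtype.ext ?_⟩
  change rho m k ⟨v, _⟩ = rho m k f
  rw [rho_apply, rho_apply, ← hvn, map_add, rhoPoly_eq_zero_of_mem_raisingSpan hn, add_zero]

/-- Schur's lemma gives injectivity unless the map is zero; being onto an image that contains a
nonzero `p_I²`, it is not. -/
lemma rhoSpecht_bijective {k : ℕ} (h : 2 * k ≤ m) : Function.Bijective (rhoSpecht h) := by
  have := isIrreducible_specht_twoRow h
  refine ⟨?_, rhoSpecht_surjective h⟩
  refine (Representation.IsIrreducible.injective_or_eq_zero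
    (V := (specht m (twoRow m k h)).toSubmodule) (W := (rho m k).range.toSubmodule)
    (rhoSpecht h)).resolve_right ?_
  intro h0
  obtain ⟨I, hI⟩ := exists_pluckerSq_ne_zero h
  obtain ⟨v, hv⟩ := rhoSpecht_surjective h ⟨rho m k (alphaMon I), _, rfl⟩
  rw [h0] at hv
  apply hI
  rw [← rhoPoly_sfMonomial I]
  exact (rho_apply (alphaMon I)).symm.trans (congrArg Subtype.val hv).symm

lemma isIrreducible_of_equiv {G V W : Type*} [Monoid G] [AddCommGroup V] [Module ℂ V]
    [AddCommGroup W] [Module ℂ W] {ρ : Representation ℂ G V} {σ : Representation ℂ G W}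
    (e : Representation.Equiv ρ σ) [ρ.IsIrreducible] : σ.IsIrreducible := by
  rw [Representation.irreducible_iff_isSimpleModule_asModule]
  let f := Representation.IntertwiningMap.equivLinearMapAsModule ρ σ e.toIntertwiningMap
  exact IsSimpleModule.congr (LinearEquiv.ofBijective f e.bijective).symm

end CobleOG

theorem proposition4p4 (m k : ℕ) (h : 2 * k ≤ m) :
    (∀ I : {I : Finset (Fin m) // I.card = k}, rho m k (alphaMon I) = pluckerSq I) ∧
    (∀ J : Finset (Fin m), J.card + 1 = k →
      ∃ hJ : sfMonomial J * ∑ a ∈ Jᶜ, MvPolynomial.X a ∈ (SF m k).toSubmodule,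
        rho m k ⟨_, hJ⟩ = 0) ∧
    Representation.IsIrreducible (k := ℂ) (V := (rho m k).range.toSubmodule)
      (rho m k).range.toRepresentation ∧
    Nonempty (Representation.Equiv (rho m k).range.toRepresentation
      (specht m (twoRow m k h)).toRepresentation) := by
  have := isIrreducible_specht_twoRow h
  let e := (rhoSpecht h).ofBijective (rhoSpecht_bijective h)
  refine ⟨fun I => ?_, fun J hJ => ⟨raisingSpan_le_SF m k ?_, ?_⟩, isIrreducible_of_equiv e,
    ⟨e.symm⟩⟩
  · rw [rho_apply]
    exact rhoPoly_sfMonomial I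
  · exact Submodule.subset_span ⟨⟨J, hJ⟩, rfl⟩
  · rw [rho_apply]
    exact rhoPoly_sfMonomial_mul_sum J hJ
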